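/- Let $R$ be a relation schema with finitely many attributes, $\Sigma$ a finite set of functional dependencies over $R$, and $I$ a finite instance (a set of tuples). A set of tuples $J$ is consistent ($J\models\Sigma$) if for every $X\to Y$ in $\Sigma$ any two tuples of $J$ that agree on $X$ agree on $Y$. A conflict of $I$ is a two-tuple subset of $I$ that is not consistent; let $C$ be the set of conflicts of $I$, $m=|C|$, and $\delta_I$ the maximum over $\mathbf t\in I$ of the number of conflicts containing $\mathbf t$. For a nonempty instance $H$ put $\mathrm{incDeg}(H,\Sigma)=\min\{|H\setminus J|/|H| : J\subseteq H,\ J\models\Sigma\}$. A ranking is a bijection $\pi:C\to\{1,\dots,m\}$. A subset query $Q$ selects $Q(I)\subseteq I$. Its $\subseteq$-oracle supports three operations: $\mathsf{sample\_tuple}()$ returns an independent uniform tuple of $Q(I)$, $\mathsf{in\_result}(\mathbf t)$ tells whether $\mathbf t\in Q(I)$, and $\mathsf{size}()$ returns $|Q(I)|$. The algorithm Fast-IncDeg is given $C$ with a ranking $\pi$ and $0<\epsilon<1$, and accesses $Q$ only through the $\subseteq$-oracle. It draws $s=\lfloor 8/\epsilon^2\rfloor$ tuples with $\mathsf{sample\_tuple}()$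 and counts the number $d$ of drawn tuples on which $\mathrm{NotInSR}$ returns true. It then calls $\mathsf{size}()$ to get $n=|Q(I)|$ and returns $\frac{(d/s)\,n}{n}+\frac\epsilon2$. Here $\mathrm{NotInSR}(\mathbf t)$ goes through the conflicts $\{\mathbf t,\mathbf s\}\in C$ in order of increasing rank; it returns true as soon as $\mathsf{in\_result}(\mathbf s)$ and $\mathrm{Eliminate}(\{\mathbf t,\mathbf s\})$ are both true (the second is evaluated only if the first is true), and returns false if this never happens. $\mathrm{Eliminate}(J)$ goes, in order of increasing rank, through the conflicts $J'\in C$ of rank lower than $J$ that meet $J$; writing $\mathbf s'$ for the tuple of $J'$ not in $J$, it returns false as soon as $\mathsf{in\_result}(\mathbf s')$ and $\mathrm{Eliminate}(J')$ are both true (evaluated in this order, as before), and returns true if this never happens. **Theorem.** (1) For every $R,\Sigma,I$, every subset query $Q$ with $Q(I)\neq\emptyset$, every ranking $\pi$ and every $0<\epsilon<1$, with probability at least $2/3$ over the sampled tuples, the value $\widetilde{\mathrm{incDeg}}$ returned by Fast-IncDeg satisfies $$\mathrm{incDeg}(Q(I),\Sigma)\le\widetilde{\mathrm{incDeg}}\le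 2\cdot\mathrm{incDeg}(Q(I),\Sigma)+\epsilon .$$ (2) There is a universal constant $K$ such that for every $R,\Sigma,I$, every finite nonempty set $\mathcal Q$ of subset queries with $Q(I)\ne\emptyset$ for all $Q\in\mathcal Q$, and every $0<\epsilon<1$, the total number of oracle calls (of all three kinds) made by Fast-IncDeg, averaged over all $m!$ rankings $\pi$, all $Q\in\mathcal Q$ and the uniform independent samples from $Q(I)$, is at most $K\cdot\max(1,\delta_I)^2/\epsilon^2$. -/

import Mathlib

/-! ### Relations, functional dependencies, inconsistency degree -/

/-- A tuple over a `k`-ary relation schema whose `i`-th attribute has domain `dom i`. -/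
abbrev DBTuple {k : ℕ} (dom : Fin k → Type) : Type := (i : Fin k) → dom i

/-- A functional dependency `lhs → rhs` between sets of attributes. -/
structure FunDep (k : ℕ) where
  lhs : Finset (Fin k)
  rhs : Finset (Fin k)

/-- `J ⊨ φ`: two tuples of `J` that agree on `φ.lhs` agree on `φ.rhs`. -/
def FunDep.Holds {k : ℕ} {dom : Fin k → Type} (φ : FunDep k) (J : Finset (DBTuple dom)) : Prop :=
  ∀ s ∈ J, ∀ t ∈ J, (∀ i ∈ φ.lhs, s i = t i) → ∀ i ∈ φ.rhs, s i = t i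

/-- `J` is consistent with respect to a finite set of functional dependencies. -/
def Consistent {k : ℕ} {dom : Fin k → Type} (F : Finset (FunDep k))
    (J : Finset (DBTuple dom)) : Prop :=
  ∀ φ ∈ F, φ.Holds J

/-- The conflicts of `I`: its two-tuple subsets that violate some dependency of `F`. -/
noncomputable def conflicts {k : ℕ} {dom : Fin k → Type} (F : Finset (FunDep k))
    (I : Finset (DBTuple dom)) : Finset (Finset (DBTuple dom)) :=
  open scoped Classical in (I.powersetCard 2).filter fun J => ¬ Consistent F J

/-- The maximum, over the tuples `t` of `I`, of the number of conflicts of `I` that contain `t`. -/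
noncomputable def maxConflicts {k : ℕ} {dom : Fin k → Type} (F : Finset (FunDep k))
    (I : Finset (DBTuple dom)) : ℕ :=
  open scoped Classical in I.sup fun t => ((conflicts F I).filter fun J => t ∈ J).card

/-- The consistent subsets of `I`. -/
noncomputable def consistentSubsets {k : ℕ} {dom : Fin k → Type} (F : Finset (FunDep k))
    (I : Finset (DBTuple dom)) : Finset (Finset (DBTuple dom)) :=
  open scoped Classical in I.powerset.filter fun J => Consistent F J

theorem consistentSubsets_nonempty {k : ℕ} {dom : Fin k → Type} (F : Finset (FunDep k))
    (I : Finset (DBTuple dom)) : (consistentSubsets F I).Nonempty :=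
  ⟨∅, by
    classical
    exact Finset.mem_filter.2 ⟨Finset.empty_mem_powerset I, by simp [Consistent, FunDep.Holds]⟩⟩

/-- The number of tuples of `I` that are missing from `J`. -/
noncomputable def distSub {k : ℕ} {dom : Fin k → Type} (J I : Finset (DBTuple dom)) : ℕ :=
  open scoped Classical in (I \ J).card

/-- The inconsistency degree: the minimum of `distSub J I / |I|` over the consistent subsets `J`
of `I`. -/
noncomputable def incDeg {k : ℕ} {dom : Fin k → Type} (F : Finset (FunDep k))
    (I : Finset (DBTuple dom)) : ℝ :=
  (consistentSubsets F I).inf' (consistentSubsets_nonempty F I)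
    fun J => (distSub J I : ℝ) / (I.card : ℝ)

/-- A subset query maps every instance to a subset of it. -/
structure SubsetQuery {k : ℕ} (dom : Fin k → Type) where
  result : Finset (DBTuple dom) → Finset (DBTuple dom)
  result_subset : ∀ I, result I ⊆ I

/-! ### Programs with access to a subset oracle -/

/-- Programs over tuples of type `T` that return an `α` and interact with the result of a subset
query only through the three oracle operations. -/
inductive OracleProg (T α : Type) : Type where
  | ret (a : α) : OracleProg T α
  | sampleTuple (next : T → OracleProg T α) : OracleProg T α
  | inResult (t : T) (next : Bool → OracleProg T α) : OracleProg T α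
  | size (next : ℕ → OracleProg T α) : OracleProg T α

namespace OracleProg

/-- Sequential composition. -/
def andThen {T α β : Type} : OracleProg T α → (α → OracleProg T β) → OracleProg T β
  | ret a, f => f a
  | sampleTuple next, f => sampleTuple fun t => (next t).andThen f
  | inResult t next, f => inResult t fun b => (next b).andThen f
  | size next, f => size fun n => (next n).andThen f

instance (T : Type) : Monad (OracleProg T) where
  pure := ret
  bind := andThen

/-- The joint law of the returned value and of the number of oracle calls, when the oracle answers
for the nonempty query result `A`: `sampleTuple` returns a uniform element of `A`, independent of
the past, `inResult t` tells whether `t ∈ A`, and `size` returns `|A|`. -/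
noncomputable def run {T α : Type} (A : Finset T) (hA : A.Nonempty) :
    OracleProg T α → PMF (α × ℕ)
  | ret a => PMF.pure (a, 0)
  | sampleTuple next => (PMF.uniformOfFinset A hA).bind fun t =>
      (run A hA (next t)).map fun x => (x.1, x.2 + 1)
  | inResult t next =>
      (run A hA (next (open scoped Classical in decide (t ∈ A)))).map fun x => (x.1, x.2 + 1)
  | size next => (run A hA (next A.card)).map fun x => (x.1, x.2 + 1)

/-- The probability that the returned value satisfies `P`. -/
noncomputable def prob {T α : Type} (A : Finset T) (hA : A.Nonempty) (p : OracleProg T α)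
    (P : α → Prop) : ENNReal :=
  (p.run A hA).toOuterMeasure {x | P x.1}

/-- The expected number of oracle calls. -/
noncomputable def expectedCalls {T α : Type} (A : Finset T) (hA : A.Nonempty)
    (p : OracleProg T α) : ENNReal :=
  ∑' x, p.run A hA x * (x.2 : ENNReal)

end OracleProg

/-! ### The algorithm -/

/-- A ranking of a finite set `C` of conflicts: a bijection onto `{0, …, |C| - 1}`. -/
abbrev Ranking {T : Type} (C : Finset (Finset T)) : Type := {J // J ∈ C} ≃ Fin C.card

/-- The conflict of rank `r`. -/
def Ranking.conflict {T : Type} {C : Finset (Finset T)} (π : Ranking C) (r : Fin C.card) :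
    Finset T :=
  (π.symm r).1

/-- If the two-tuple set `J` is `{a, s}` with `a ∈ A` and `s ∉ A`, this is `some s`;
if `J` does not meet `A`, it is `none`. -/
noncomputable def partner {T : Type} (A J : Finset T) : Option T :=
  open scoped Classical in if Disjoint A J then none else (J \ A).toList.head?

/-- `Eliminate` on the conflict of rank `r`: go through the conflicts of lower rank that meet it, in
increasing order of rank. If the other tuple of such a conflict is in the query result and the
recursive call on that conflict returns `true`, return `false`. Otherwise return `true`. -/
noncomputable def eliminate {T : Type} {C : Finset (Finset T)} (π : Ranking C) (r : ℕ)
    (hr : r < C.card) : OracleProg T Bool := do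
  let found ← (List.finRange r).anyM fun i =>
    match partner (π.conflict ⟨r, hr⟩) (π.conflict ⟨i.1, i.2.trans hr⟩) with
    | none => pure false
    | some s => OracleProg.inResult s fun b =>
        if b then eliminate π i.1 (i.2.trans hr) else pure false
  pure (!found)
termination_by r
decreasing_by exact i.2

/-- `NotInSR` on the tuple `t`: go through the conflicts that contain `t`, in increasing order of
rank. If the other tuple of such a conflict is in the query result and `eliminate` returns `true` on
that conflict, return `true`. Otherwise return `false`. -/
noncomputable def notInSR {T : Type} {C : Finset (Finset T)} (π : Ranking C) (t : T) :
    OracleProg T Bool :=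
  (List.finRange C.card).anyM fun i =>
    match partner {t} (π.conflict i) with
    | none => pure false
    | some s => OracleProg.inResult s fun b =>
        if b then eliminate π i.1 i.2 else pure false

/-- Sample `p` tuples one after the other and count those on which `notInSR` returns `true`,
starting from the count `d`. -/
noncomputable def countNotInSR {T : Type} {C : Finset (Finset T)} (π : Ranking C) :
    ℕ → ℕ → OracleProg T ℕ
  | 0, d => pure d
  | p + 1, d => OracleProg.sampleTuple fun t => do
      let b ← notInSR π t
      countNotInSR π p (if b then d + 1 else d)

/-- The number of samples. -/
noncomputable def numSamples (ε : ℝ) : ℕ := ⌊8 / ε ^ 2⌋₊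

/-- `Fast-IncDeg`: among `numSamples ε` sampled tuples let `d` be the number of those not in the
repair. Scaled up to the whole query result of size `n`, this is `d / numSamples ε * n` tuples to
delete; divide by the size and add `ε / 2`. -/
noncomputable def fastIncDeg {T : Type} {C : Finset (Finset T)} (π : Ranking C) (ε : ℝ) :
    OracleProg T ℝ := do
  let d ← countNotInSR π (numSamples ε) 0
  OracleProg.size fun n => pure ((d : ℝ) / (numSamples ε : ℝ) * (n : ℝ) / (n : ℝ) + ε / 2)

/-- The average number of oracle calls of `fastIncDeg`, over all rankings of the conflicts of `I`,
all queries of the finite query space `Qs` and all outcomes of the sampling of tuples from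
the query result. -/
noncomputable def averageCalls {k : ℕ} {dom : Fin k → Type} (F : Finset (FunDep k))
    (I : Finset (DBTuple dom)) (Qs : Finset (SubsetQuery dom))
    (hQs : ∀ Q ∈ Qs, (Q.result I).Nonempty) (ε : ℝ) : ENNReal :=
  open scoped Classical in
  (∑ π : Ranking (conflicts F I),
    (∑ Q ∈ Qs.attach,
      (fastIncDeg π ε).expectedCalls (Q.1.result I) (hQs Q.1 Q.2)) / (Qs.card : ENNReal)) /
    ((conflicts F I).card.factorial : ENNReal)

/-!
Call a conflict live when both of its tuples belong to the query result `A`. For a fixed ranking,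
`eliminate` decides whether a live conflict belongs to the greedy matching, built by going through
the live conflicts by increasing rank and picking those that share no tuple with a conflict picked
before; `notInSR` decides whether a tuple is covered by this matching (`run_eliminate`,
`run_notInSR`).

*Accuracy.* Let `μ` be the fraction of covered tuples. The greedy matching is maximal, so deleting
the covered tuples leaves a consistent set, and every consistent subset of `A` misses a tuple of
each of its edges; hence `incDeg ≤ μ ≤ 2 * incDeg` (`incDeg_le_card_covered`,
`card_covered_le_two_mul_incDeg`). The number of successes among `s` samples has mean `s μ` and
variance at most `s / 4`, and Chebyshev's inequality with `s ε² ≥ 3` finishes the proof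
(`two_thirds_le_prob_fastIncDeg`).

*Cost.* The oracle calls of a search are the nodes of a call tree, that is, the paths
`w_k, …, w_1 = v, w_0 = u` of conflicts of decreasing rank in which each conflict calls the next:
the caller is live and shares no tuple with a greedy conflict of rank below that of the callee.
Conflicts with one tuple outside `A` occur only as ends of such paths. For fixed `u` and `v`, let a
pair of a ranking `π` and such a path be mapped to the ranking that gives `w_i` the rank of
`w_(i - 2)`, cyclically. This map is injective (`callPath_unique`): two different paths with the
same image diverge at some vertex `w_(j + 1)`, and the one whose continuation has the smaller rank
puts a greedy neighbour in front of the call that the other one makes (`not_diverge`). So a pair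
`(v, u)` of adjacent conflicts is the last step of at most one call path on average over the
rankings (`sum_sum_callTreeSize_le`). With `D` the largest number of conflicts per tuple, at least
`1`, there are at most `2 |A| D²` such pairs with `v` meeting `A`, so a search from a uniform tuple
of `A` makes `O(D²)` calls on average, and there are at most `8 / ε²` searches.
-/

/-! ### Greedy sets and the call tree of their local exploration -/

section Greedy

variable {V : Type*} {m : ℕ}

/-- The set built by the greedy algorithm that goes through the vertices in the order `π` and picks
every live vertex none of whose neighbours has been picked: `Greedy G live π v` says that `v` is
picked. -/
def Greedy (G : SimpleGraph V) (live : V → Prop) (π : V ≃ Fin m) (v : V) : Prop :=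
  live v ∧ ∀ y, G.Adj v y → (_ : π y < π v) → ¬ Greedy G live π y
termination_by π v

theorem greedy_iff {G : SimpleGraph V} {live : V → Prop} {π : V ≃ Fin m} {v : V} :
    Greedy G live π v ↔ live v ∧ ∀ y, G.Adj v y → π y < π v → ¬ Greedy G live π y := by
  rw [Greedy]

/-- The local exploration of the live vertex `v` visits its lower neighbours in increasing order
until it meets one in the greedy set: `Calls G live π v u` says that `u` is visited. -/
def Calls (G : SimpleGraph V) (live : V → Prop) (π : V ≃ Fin m) (v u : V) : Prop :=
  live v ∧ G.Adj v u ∧ π u < π v ∧ ∀ z, G.Adj v z → π z < π u → ¬ Greedy G live π z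

variable {G : SimpleGraph V} {live : V → Prop}

/-- Two orders with the same initial segment below `α` have the same greedy set there. -/
theorem greedy_congr_of_lt {π₁ π₂ : V ≃ Fin m} {α : Fin m}
    (h₁ : ∀ z, π₁ z < α → π₂ z = π₁ z) (h₂ : ∀ z, π₂ z < α → π₂ z = π₁ z) (z : V)
    (hz : π₁ z < α) : Greedy G live π₁ z ↔ Greedy G live π₂ z := by
  induction hr : π₁ z using WellFoundedLT.induction generalizing z with
  | ind r ih =>
    subst hr
    rw [greedy_iff, greedy_iff, h₁ z hz]
    refine and_congr_right fun _ => forall_congr' fun y => imp_congr_right fun _ => ?_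
    constructor
    · intro h hy
      have e := h₂ y (hy.trans hz)
      rw [e] at hy
      rw [← ih _ hy y (hy.trans hz) rfl]
      exact h hy
    · intro h hy
      have e := h₁ y (hy.trans hz)
      rw [ih _ hy y (hy.trans hz) rfl]
      exact h (e ▸ hy)

section Rotation

variable [DecidableEq V] {π τ : V ≃ Fin m} {l : List V}

/-- The square of the cyclic permutation of `l` shifts by two places: if `π` is `τ` after this
shift, the rank of `l[i]` under `π` is the rank of `l[i + 2]` under `τ`. -/
theorem rotate_apply_getElem (hl : l.Nodup) (e : π = Equiv.trans (l.formPerm ^ 2) τ) {i : ℕ}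
    (hi : i + 2 < l.length) : τ l[i + 2] = π l[i] := by
  subst e
  simp [List.formPerm_pow_apply_getElem l hl 2 i (by omega), Nat.mod_eq_of_lt hi]

/-- Past the end of the list the shift by two places wraps around: the last but one vertex takes
the rank of the first. -/
theorem rotate_apply_getElem_length {u v : V} {r : List V} (hl : (u :: v :: r).Nodup)
    (e : π = Equiv.trans ((u :: v :: r).formPerm ^ 2) τ) : π (u :: v :: r)[r.length] = τ u := by
  rw [e, Equiv.trans_apply, List.formPerm_pow_apply_getElem _ hl 2 r.length (by simp)]
  simp

theorem rotate_apply_of_notMem (e : π = Equiv.trans (l.formPerm ^ 2) τ) {z : V} (hz : z ∉ l) :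
    π z = τ z := by
  subst e
  simp [pow_two, List.formPerm_apply_of_notMem hz]

end Rotation

/-- Along an ascending call path ranks increase. -/
theorem rank_lt_of_isChain {π : V ≃ Fin m} {l : List V}
    (h : l.IsChain fun a b => Calls G live π b a) {i j : ℕ} (hj : j < l.length) (hij : i < j) :
    π l[i] < π l[j] := by
  have h' : l.IsChain fun a b => π a < π b := h.imp fun a b hab => hab.2.2.1
  have : Trans (fun a b : V => π a < π b) (fun a b => π a < π b) (fun a b => π a < π b) :=
    ⟨fun h k => lt_trans h k⟩
  exact List.pairwise_iff_getElem.1 h'.pairwise i j (by omega) hj hij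

theorem index_lt_of_rank_lt {π : V ≃ Fin m} {l : List V}
    (h : l.IsChain fun a b => Calls G live π b a) {i j : ℕ} (hi : i < l.length) (hj : j < l.length)
    (hij : π l[i] < π l[j]) : i < j := by
  by_contra hc
  rcases (not_lt.1 hc).eq_or_lt with rfl | hlt
  · exact lt_irrefl _ hij
  · exact lt_asymm hij (rank_lt_of_isChain h hi hlt)

theorem nodup_of_isChain_calls {π : V ≃ Fin m} {l : List V}
    (h : l.IsChain fun a b => Calls G live π b a) : l.Nodup := by
  rw [List.nodup_iff_getElem?_ne_getElem?]
  intro i j hij hj heq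
  rw [List.getElem?_eq_getElem (hij.trans hj), List.getElem?_eq_getElem hj, Option.some_inj] at heq
  exact (rank_lt_of_isChain h hj hij).ne (congrArg π heq)

/-- Two call paths for orders with a common rotation `τ` cannot diverge. Suppose that they agree up
to index `j + 1` and that `l₁` continues with `y`. Below the rank `α` of `l₁[j]` the two orders
coincide. As `y` calls `l₁[j + 1]` in the first order, no greedy neighbour of `y` lies below `α`; in
the second order `y` has rank `α`, so it is in the greedy set. Hence `l₂[j + 1]` sees `y` before
`l₂[j]` and does not call `l₂[j]`. -/
theorem not_diverge [DecidableEq V] {π₁ π₂ τ : V ≃ Fin m} {l₁ l₂ : List V}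
    (h₁ : l₁.IsChain fun a b => Calls G live π₁ b a)
    (h₂ : l₂.IsChain fun a b => Calls G live π₂ b a)
    (e₁ : π₁ = Equiv.trans (l₁.formPerm ^ 2) τ) (e₂ : π₂ = Equiv.trans (l₂.formPerm ^ 2) τ) {j : ℕ}
    (hj₁ : j + 2 < l₁.length) (hj₂ : j + 1 < l₂.length)
    (agree : ∀ (i : ℕ) (_ : i ≤ j + 1), l₁[i] = l₂[i])
    (lt : π₁ l₁[j] < π₂ l₂[j]) : False := by
  have n₁ := nodup_of_isChain_calls h₁
  have n₂ := nodup_of_isChain_calls h₂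
  have shared : ∀ (i : ℕ) (_ : i < j), π₂ l₁[i] = π₁ l₁[i] := by
    intro i hi
    have a := rotate_apply_getElem n₁ e₁ (i := i) (by omega)
    have b := rotate_apply_getElem n₂ e₂ (i := i) (by omega)
    rw [← a, agree (i + 2) (by omega), b, agree i (by omega)]
  have low₁ : ∀ z ∈ l₁, z ∉ l₂ → π₁ l₁[j] ≤ τ z := by
    intro z hz hz'
    obtain ⟨i, hi, rfl⟩ := List.getElem_of_mem hz
    have : ¬ i ≤ j + 1 := fun h => hz' (agree i h ▸ List.getElem_mem _)
    obtain ⟨i, rfl⟩ := Nat.exists_eq_add_of_le' (show 2 ≤ i by omega)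
    rw [rotate_apply_getElem n₁ e₁ hi]
    rcases (show j ≤ i by omega).eq_or_lt with rfl | hlt
    · exact le_rfl
    · exact (rank_lt_of_isChain h₁ _ hlt).le
  have low₂ : ∀ (i : ℕ) (hi : i < l₂.length), j + 1 < i → π₁ l₁[j] < τ l₂[i] := by
    intro i hi hji
    obtain ⟨i, rfl⟩ := Nat.exists_eq_add_of_le' (show 2 ≤ i by omega)
    rw [rotate_apply_getElem n₂ e₂ hi]
    rcases (show j ≤ i by omega).eq_or_lt with rfl | hlt
    · exact lt
    · exact lt.trans (rank_lt_of_isChain h₂ _ hlt)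
  have c₁ : ∀ z, π₁ z < π₁ l₁[j] → π₂ z = π₁ z := by
    intro z hz
    by_cases hz₁ : z ∈ l₁
    · obtain ⟨i, hi, rfl⟩ := List.getElem_of_mem hz₁
      exact shared i (index_lt_of_rank_lt h₁ _ _ hz)
    · rw [rotate_apply_of_notMem e₁ hz₁] at hz ⊢
      refine rotate_apply_of_notMem e₂ fun hz₂ => ?_
      obtain ⟨i, hi, rfl⟩ := List.getElem_of_mem hz₂
      have : ¬ i ≤ j + 1 := fun h => hz₁ (agree i h ▸ List.getElem_mem _)
      exact lt_asymm hz (low₂ i hi (by omega))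
  have c₂ : ∀ z, π₂ z < π₁ l₁[j] → π₂ z = π₁ z := by
    intro z hz
    by_cases hz₂ : z ∈ l₂
    · obtain ⟨i, hi, rfl⟩ := List.getElem_of_mem hz₂
      have := index_lt_of_rank_lt h₂ _ _ (hz.trans lt)
      rw [← agree i (by omega)]
      exact shared i this
    · rw [rotate_apply_of_notMem e₂ hz₂] at hz ⊢
      refine (rotate_apply_of_notMem e₁ fun hz₁ => ?_).symm
      exact absurd hz (not_lt.2 (low₁ z hz₁ hz₂))
  have hy : π₂ l₁[j + 2] = π₁ l₁[j] := by
    have a := rotate_apply_getElem n₁ e₁ hj₁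
    rw [← a]
    refine rotate_apply_of_notMem e₂ fun hy₂ => ?_
    obtain ⟨i, hi, hiy⟩ := List.getElem_of_mem hy₂
    by_cases hij : i ≤ j + 1
    · rw [← agree i hij] at hiy
      have := (n₁.getElem_inj_iff).1 hiy
      omega
    · have := low₂ i hi (by omega)
      rw [hiy, a] at this
      exact lt_irrefl _ this
  have k₁ := List.isChain_iff_getElem.1 h₁ (j + 1) hj₁
  have k₂ := List.isChain_iff_getElem.1 h₂ j hj₂
  have hadj : G.Adj l₂[j + 1] l₁[j + 2] := by
    rw [← agree (j + 1) le_rfl]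
    exact k₁.2.1.symm
  refine k₂.2.2.2 _ hadj (hy ▸ lt) (greedy_iff.2 ⟨k₁.1, fun z hz hlt => ?_⟩)
  rw [hy] at hlt
  have e := c₂ z hlt
  rw [e] at hlt
  rw [← greedy_congr_of_lt c₁ c₂ z hlt]
  exact k₁.2.2.2 z hz (hlt.trans (rank_lt_of_isChain h₁ _ (Nat.lt_succ_self j)))

/-- The last step of a call path and the order rotated along the path determine the path. -/
theorem callPath_unique [DecidableEq V] {π₁ π₂ τ : V ≃ Fin m} {u v : V} {r₁ r₂ : List V}
    (h₁ : (u :: v :: r₁).IsChain fun a b => Calls G live π₁ b a)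
    (h₂ : (u :: v :: r₂).IsChain fun a b => Calls G live π₂ b a)
    (e₁ : π₁ = Equiv.trans ((u :: v :: r₁).formPerm ^ 2) τ)
    (e₂ : π₂ = Equiv.trans ((u :: v :: r₂).formPerm ^ 2) τ) :
    r₁ = r₂ := by
  -- The first index at which the two paths differ, or at which only one of them goes on.
  by_contra hne
  have hex : ∃ i : ℕ, r₁[i]? ≠ r₂[i]? := by
    by_contra! hc
    exact hne (List.ext_getElem? hc)
  classical
  let j := Nat.find hex
  have hj : r₁[j]? ≠ r₂[j]? := Nat.find_spec hex
  have hlt : ∀ i < j, r₁[i]? = r₂[i]? := fun i hi => not_not.1 (Nat.find_min hex hi)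
  clear_value j
  wlog hlen : j < r₁.length generalizing r₁ r₂ π₁ π₂ with H
  · by_cases hlen₂ : j < r₂.length
    · exact H h₂ h₁ e₂ e₁ (Ne.symm hne) (by simpa only [ne_comm] using hex) hj.symm
        (fun i hi => (hlt i hi).symm) hlen₂
    · exact hj (by rw [List.getElem?_eq_none (by omega), List.getElem?_eq_none (by omega)])
  have hle₂ : j ≤ r₂.length := by
    by_contra hc
    have := hlt r₂.length (by omega)
    rw [List.getElem?_eq_getElem (by omega), List.getElem?_eq_none le_rfl] at this
    exact absurd this (by simp)
  have agree : ∀ (i : ℕ) (_ : i ≤ j + 1) (a : i < (u :: v :: r₁).length)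
      (b : i < (u :: v :: r₂).length), (u :: v :: r₁)[i] = (u :: v :: r₂)[i] := by
    intro i hi a b
    rcases i with _ | _ | i
    · rfl
    · rfl
    · have := hlt i (by omega)
      simp only [List.length_cons] at a b
      rw [List.getElem?_eq_getElem (by omega), List.getElem?_eq_getElem (by omega),
        Option.some_inj] at this
      simpa using this
  have L₁ : j + 2 < (u :: v :: r₁).length := by simpa using hlen
  have L₂ : j + 1 < (u :: v :: r₂).length := by simp only [List.length_cons]; omega
  have n₁ := nodup_of_isChain_calls h₁
  have n₂ := nodup_of_isChain_calls h₂
  have hv₁ : π₁ (u :: v :: r₁)[j] = τ (u :: v :: r₁)[j + 2] := (rotate_apply_getElem n₁ e₁ L₁).symm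
  rcases hle₂.lt_or_eq with hlen₂ | hlen₂
  · have L₂' : j + 2 < (u :: v :: r₂).length := by simpa using hlen₂
    have hv₂ : π₂ (u :: v :: r₂)[j] = τ (u :: v :: r₂)[j + 2] :=
      (rotate_apply_getElem n₂ e₂ L₂').symm
    rcases lt_trichotomy (π₁ (u :: v :: r₁)[j]) (π₂ (u :: v :: r₂)[j]) with h | h | h
    · exact not_diverge h₁ h₂ e₁ e₂ L₁ L₂ (fun i hi => agree i hi _ _) h
    · rw [hv₁, hv₂] at h
      have := τ.injective h
      simp only [List.getElem_cons_succ] at this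
      rw [List.getElem?_eq_getElem hlen, List.getElem?_eq_getElem hlen₂] at hj
      exact hj (congrArg some this)
    · exact not_diverge h₂ h₁ e₂ e₁ L₂' (by omega) (fun i hi => (agree i hi _ _).symm) h
  · -- The second path ends at index `j + 1`. By wrap-around its vertex of index `j` has rank `τ u`
    -- under `π₂`, and so has the last but one vertex of the longer first path under `π₁`.
    refine not_diverge h₁ h₂ e₁ e₂ L₁ L₂ (fun i hi => agree i hi _ _) ?_
    have hv₂ : π₂ (u :: v :: r₂)[j] = τ u := by
      subst hlen₂
      exact rotate_apply_getElem_length n₂ e₂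
    have hu : τ u = π₁ (u :: v :: r₁)[r₁.length] := (rotate_apply_getElem_length n₁ e₁).symm
    rw [hv₂, hu]
    exact rank_lt_of_isChain h₁ _ hlen

end Greedy

section CallPaths

variable {V : Type*} [Fintype V] {m : ℕ} (G : SimpleGraph V) (live : V → Prop)

theorem finite_setOf_isChain_calls (π : V ≃ Fin m) :
    {l : List V | l.IsChain (Calls G live π)}.Finite := by
  classical
  refine (Set.finite_coe_iff.1 (inferInstance : Finite {l : List V // l.Nodup})).subset
    fun l hl => List.nodup_reverse.1 (nodup_of_isChain_calls (List.isChain_reverse.2 hl))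

/-- The call paths of the local exploration, root first. The paths with root `v` are the nodes of
the call tree of `v`. -/
noncomputable def callPaths (π : V ≃ Fin m) : Finset (List V) :=
  (finite_setOf_isChain_calls G live π).toFinset

/-- The number of nodes of the call tree of `v`. -/
noncomputable def callTreeSize (π : V ≃ Fin m) (v : V) : ℕ :=
  open scoped Classical in ((callPaths G live π).filter fun l => ∃ t, l = v :: t).card

variable {G live}

theorem mem_callPaths {π : V ≃ Fin m} {l : List V} :
    l ∈ callPaths G live π ↔ l.IsChain (Calls G live π) := by
  simp [callPaths]

open scoped Classical in
theorem one_add_sum_callTreeSize_le (π : V ≃ Fin m) (v : V) :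
    1 + ∑ u with Calls G live π v u, callTreeSize G live π u ≤ callTreeSize G live π v := by
  have hd : ((Finset.univ.filter fun u => Calls G live π v u : Finset V) : Set V).PairwiseDisjoint
      fun u => (callPaths G live π).filter fun l => ∃ t, l = u :: t := by
    intro a _ b _ hab
    refine Finset.disjoint_left.2 fun l ha hb => hab ?_
    obtain ⟨t, rfl⟩ := (Finset.mem_filter.1 ha).2
    obtain ⟨s, hs⟩ := (Finset.mem_filter.1 hb).2
    exact (List.cons.inj hs).1
  unfold callTreeSize
  rw [← Finset.card_biUnion hd, add_comm,
    ← Finset.card_image_of_injective _ (List.cons_injective (a := v))]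
  rw [← Finset.card_insert_of_notMem (a := [v])]
  · refine Finset.card_le_card fun l hl => ?_
    rw [Finset.mem_insert, Finset.mem_image] at hl
    rw [Finset.mem_filter, mem_callPaths]
    rcases hl with rfl | ⟨l, hl, rfl⟩
    · simp
    · rw [Finset.mem_biUnion] at hl
      obtain ⟨u, hu, hl⟩ := hl
      rw [Finset.mem_filter, mem_callPaths] at hl
      obtain ⟨t, rfl⟩ := hl.2
      exact ⟨List.isChain_cons_cons.2 ⟨(Finset.mem_filter.1 hu).2, hl.1⟩, _, rfl⟩
  · simp

/-- The expectation over a uniformly random order of the total size of the call trees of the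
vertices in `S` exceeds `|S|` by at most the number of edges, directed away from a live
vertex. A path with at least one step is charged to its last step: rotating the order along the
path is injective on the pairs of an order and a path with that last step. -/
theorem sum_sum_callTreeSize_le [DecidableEq V] (S : Finset V) (E : Finset (V × V))
    (hE : ∀ v u, live v → G.Adj v u → (u, v) ∈ E) :
    ∑ π : V ≃ Fin m, ∑ v ∈ S, callTreeSize G live π v ≤
      (S.card + E.card) * Fintype.card (V ≃ Fin m) := by
  classical
  have hroot : ∀ π : V ≃ Fin m, ∑ v ∈ S, callTreeSize G live π v ≤
      S.card + ((callPaths G live π).filter fun l => 2 ≤ l.length).card := by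
    intro π
    have hd : (S : Set V).PairwiseDisjoint
        fun u => (callPaths G live π).filter fun l => ∃ t, l = u :: t := by
      intro a _ b _ hab
      refine Finset.disjoint_left.2 fun l ha hb => hab ?_
      obtain ⟨t, rfl⟩ := (Finset.mem_filter.1 ha).2
      obtain ⟨s, hs⟩ := (Finset.mem_filter.1 hb).2
      exact (List.cons.inj hs).1
    unfold callTreeSize
    rw [← Finset.card_biUnion hd]
    refine (Finset.card_le_card (t := S.image (fun v => [v]) ∪
      (callPaths G live π).filter fun l => 2 ≤ l.length) fun l hl => ?_).trans
      ((Finset.card_union_le _ _).trans (Nat.add_le_add_right Finset.card_image_le _))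
    obtain ⟨v, hv, hl⟩ := Finset.mem_biUnion.1 hl
    rw [Finset.mem_filter] at hl
    obtain ⟨t, rfl⟩ := hl.2
    rw [Finset.mem_union]
    cases t with
    | nil => exact Or.inl (Finset.mem_image_of_mem _ hv)
    | cons a t => exact Or.inr (Finset.mem_filter.2 ⟨hl.1, by simp⟩)
  refine (Finset.sum_le_sum fun π _ => hroot π).trans ?_
  rw [Finset.sum_add_distrib, Finset.sum_const, Finset.card_univ, smul_eq_mul, add_mul,
    mul_comm S.card, ← Finset.card_sigma, ← Finset.card_univ (α := V ≃ Fin m),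
    ← Finset.card_product E Finset.univ]
  refine Nat.add_le_add_left ?_ _
  have key : ∀ x ∈ Finset.univ.sigma fun π : V ≃ Fin m =>
      (callPaths G live π).filter fun l => 2 ≤ l.length,
      ∃ u v r, x.2.reverse = u :: v :: r ∧
        (u :: v :: r).IsChain fun a b => Calls G live x.1 b a := by
    rintro ⟨π, l⟩ hx
    rw [Finset.mem_sigma, Finset.mem_filter, mem_callPaths] at hx
    have hc : l.reverse.IsChain fun a b => Calls G live π b a := List.isChain_reverse.2 hx.2.1
    have hlen : 2 ≤ l.reverse.length := by simpa using hx.2.2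
    rw [← List.reverse_reverse l] at hlen
    change ∃ u v r, l.reverse = u :: v :: r ∧ _
    generalize l.reverse = l' at hc hlen ⊢
    rcases l' with _ | ⟨u, _ | ⟨v, r⟩⟩
    · simp at hlen
    · simp at hlen
    · exact ⟨u, v, r, rfl, hc⟩
  rcases isEmpty_or_nonempty V with hV | hV
  · refine (Finset.card_eq_zero.2 (Finset.eq_empty_of_forall_notMem fun x hx => ?_)).trans_le
      (Nat.zero_le _)
    obtain ⟨u, -⟩ := key x hx
    exact hV.elim u
  choose! u v r hrev hch using key
  refine Finset.card_le_card_of_injOn (t := E ×ˢ (Finset.univ : Finset (V ≃ Fin m)))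
    (fun x => ((u x, v x), Equiv.trans (x.2.reverse.formPerm ^ 2)⁻¹ x.1)) ?_ ?_
  · intro x hx
    refine Finset.mem_product.2 ⟨?_, Finset.mem_univ _⟩
    have hc := List.isChain_cons_cons.1 (hch x hx)
    exact hE _ _ hc.1.1 hc.1.2.1
  · intro x hx y hy hxy
    simp only [Prod.mk.injEq] at hxy
    obtain ⟨⟨hu, hv⟩, hτ⟩ := hxy
    have undo : ∀ (σ : Equiv.Perm V) (π : V ≃ Fin m), π = Equiv.trans σ (Equiv.trans σ⁻¹ π) := by
      intro σ π
      ext z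
      simp
    have ex := undo (x.2.reverse.formPerm ^ 2) x.1
    have ey := undo (y.2.reverse.formPerm ^ 2) y.1
    rw [← hτ] at ey
    rw [hrev x hx] at ex hτ
    rw [hrev y hy] at ey hτ
    have h₂ := hch y hy
    rw [← hu, ← hv] at h₂ ey
    rw [hrev x hx] at ey
    have hr := callPath_unique (hch x hx) h₂ ex ey
    have hl : x.2 = y.2 := by
      rw [← List.reverse_inj, hrev x hx, hrev y hy, hu, hv, hr]
    have hπ : x.1 = y.1 := by
      rw [ey, ← hr]
      exact ex
    exact Sigma.ext hπ (heq_of_eq hl)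

end CallPaths

/-! ### The law of a run -/

namespace OracleProg

variable {T α β : Type} {A : Finset T} {hA : A.Nonempty}

theorem run_andThen (p : OracleProg T α) (f : α → OracleProg T β) :
    (p.andThen f).run A hA =
      (p.run A hA).bind fun x => ((f x.1).run A hA).map fun y => (y.1, x.2 + y.2) := by
  induction p with
  | ret a =>
    simp only [andThen, run, PMF.pure_bind, zero_add]
    exact (PMF.map_id _).symm
  | sampleTuple next ih =>
    simp only [andThen, run, ih, PMF.bind_bind, PMF.map_bind, PMF.bind_map, PMF.map_comp]
    congr! 3 with t
    funext x
    simp only [Function.comp_apply]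
    congr 1
    funext y
    simp [add_right_comm]
  | inResult t next ih =>
    simp only [andThen, run, ih, PMF.map_bind, PMF.bind_map, PMF.map_comp]
    congr 1
    funext x
    simp only [Function.comp_apply]
    congr 1
    funext y
    simp [add_right_comm]
  | size next ih =>
    simp only [andThen, run, ih, PMF.map_bind, PMF.bind_map, PMF.map_comp]
    congr 1
    funext x
    simp only [Function.comp_apply]
    congr 1
    funext y
    simp [add_right_comm]

theorem run_andThen_of_pure {p : OracleProg T α} {f : α → OracleProg T β} {a : α} {n : ℕ}
    (hp : p.run A hA = PMF.pure (a, n)) :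
    (p.andThen f).run A hA = ((f a).run A hA).map fun y => (y.1, n + y.2) := by
  rw [run_andThen, hp, PMF.pure_bind]

theorem run_andThen_of_pure_of_pure {p : OracleProg T α} {f : α → OracleProg T β} {a : α} {b : β}
    {n k : ℕ} (hp : p.run A hA = PMF.pure (a, n)) (hf : (f a).run A hA = PMF.pure (b, k)) :
    (p.andThen f).run A hA = PMF.pure (b, n + k) := by
  rw [run_andThen_of_pure hp, hf, PMF.pure_map]

/-- A search through an increasing list pays only for the entries that no successful entry
precedes. -/
theorem run_anyM {ι : Type} [LinearOrder ι] (f : ι → OracleProg T Bool) (b : ι → Bool) (c : ι → ℕ)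
    (l : List ι) (hl : l.Pairwise (· < ·))
    (h : ∀ i ∈ l, (f i).run A hA = PMF.pure (b i, c i)) :
    ∃ n, (l.anyM f).run A hA = PMF.pure (l.any b, n) ∧
      ∀ s : Finset ι, (∀ i ∈ l, (∀ k ∈ l, k < i → b k = false) → i ∈ s) → n ≤ ∑ i ∈ s, c i := by
  induction l with
  | nil => exact ⟨0, rfl, fun _ _ => Nat.zero_le _⟩
  | cons i l ih =>
    rw [List.pairwise_cons] at hl
    obtain ⟨n, hn, hle⟩ := ih hl.2 fun k hk => h k (List.mem_cons_of_mem _ hk)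
    have hi := h i List.mem_cons_self
    have hfirst : ∀ k ∈ i :: l, k < i → b k = false := by
      intro k hk hki
      rcases List.mem_cons.1 hk with rfl | hk
      · exact absurd hki (lt_irrefl _)
      · exact absurd hki (lt_asymm (hl.1 k hk))
    rcases hb : b i with _ | _
    · refine ⟨c i + n, ?_, ?_⟩
      · rw [hb] at hi
        have : (List.anyM f (i :: l)).run A hA = PMF.pure (l.any b, c i + n) :=
          run_andThen_of_pure_of_pure hi hn
        rw [this, List.any_cons, hb, Bool.false_or]
      · intro s hs
        rw [← Finset.add_sum_erase _ _ (hs i List.mem_cons_self hfirst)]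
        refine Nat.add_le_add_left (hle _ fun j hj hjb => Finset.mem_erase.2 ⟨(hl.1 j hj).ne', ?_⟩) _
        refine hs j (List.mem_cons_of_mem _ hj) fun k hk hkj => ?_
        rcases List.mem_cons.1 hk with rfl | hk
        · exact hb
        · exact hjb k hk hkj
    · refine ⟨c i + 0, ?_, ?_⟩
      · rw [hb] at hi
        have : (List.anyM f (i :: l)).run A hA = PMF.pure (true, c i + 0) :=
          run_andThen_of_pure_of_pure hi rfl
        rw [this, List.any_cons, hb, Bool.true_or]
      · exact fun s hs => Finset.single_le_sum (f := c) (fun _ _ => Nat.zero_le _)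
          (hs i List.mem_cons_self hfirst)

end OracleProg

/-! ### The conflict graph -/

section ConflictGraph

variable {T : Type}

/-- The graph on a set of conflicts in which two conflicts are adjacent when they share a tuple; its
independent sets are the matchings formed by conflicts. -/
def conflictGraph (C : Finset (Finset T)) : SimpleGraph {J // J ∈ C} where
  Adj J J' := J ≠ J' ∧ ¬ Disjoint J.1 J'.1
  symm := ⟨fun _ _ h => ⟨h.1.symm, fun hd => h.2 hd.symm⟩⟩
  loopless := ⟨fun _ h => h.1 rfl⟩

/-- If the two-tuple set `J` meets `D` without being contained in it, its other tuple decides, for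
every `A` containing `D`, whether `J` lies in `A`. -/
theorem exists_partner_eq_some {D J : Finset T} (hJ : J.card = 2) (hd : ¬ Disjoint D J)
    (hs : ¬ J ⊆ D) : ∃ s, partner D J = some s ∧ ∀ A, D ⊆ A → (s ∈ A ↔ J ⊆ A) := by
  classical
  have h1 : 0 < (J ∩ D).card := by
    rw [Finset.card_pos, ← Finset.not_disjoint_iff_nonempty_inter, disjoint_comm]
    exact hd
  have h2 : 0 < (J \ D).card := by
    rw [Finset.card_pos, Finset.sdiff_nonempty]
    exact hs
  have h3 := Finset.card_sdiff_add_card_inter J D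
  obtain ⟨s, hs⟩ := Finset.card_eq_one.1 (show (J \ D).card = 1 by omega)
  refine ⟨s, ?_, fun A hA => ⟨fun hsA x hx => ?_, fun h => h ?_⟩⟩
  · have hs' : (@SDiff.sdiff _ (@Finset.instSDiff T fun a b => Classical.propDecidable (a = b)) J D)
        = {s} := by
      convert hs
    rw [partner, if_neg hd, hs', Finset.toList_singleton, List.head?_cons]
  · by_cases hxD : x ∈ D
    · exact hA hxD
    · have : x ∈ J \ D := Finset.mem_sdiff.2 ⟨hx, hxD⟩
      rw [hs, Finset.mem_singleton] at this
      exact this ▸ hsA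
  · have : s ∈ J \ D := by rw [hs]; exact Finset.mem_singleton_self s
    exact (Finset.mem_sdiff.1 this).1

variable {C : Finset (Finset T)} {A : Finset T} {hA : A.Nonempty} {π : Ranking C}

theorem one_le_callTreeSize (v : {J // J ∈ C}) :
    1 ≤ callTreeSize (conflictGraph C) (fun J => J.1 ⊆ A) π v :=
  le_of_add_le_left (one_add_sum_callTreeSize_le π v)

open scoped Classical in
/-- One round of the loops in `eliminate` and `notInSR`, for the conflict `v` and the tuples `D`
known to be in the query result. A conflict that leaves the query result still costs its
`inResult` call; it is a non-live vertex, whose call tree is a single node. -/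
theorem run_visit (hC : ∀ J ∈ C, J.card = 2) (D : Finset T) (hD : D ⊆ A) (v : {J // J ∈ C})
    (hv : ¬ v.1 ⊆ D) (p : OracleProg T Bool)
    (hp : v.1 ⊆ A → ∃ n, p.run A hA =
        PMF.pure (decide (Greedy (conflictGraph C) (fun J => J.1 ⊆ A) π v), n) ∧
      n + 1 ≤ callTreeSize (conflictGraph C) (fun J => J.1 ⊆ A) π v) :
    ∃ n, (match partner D v.1 with
        | none => pure false
        | some s => OracleProg.inResult s fun b => if b then p else pure false).run A hA =
      PMF.pure (decide (¬ Disjoint D v.1 ∧ Greedy (conflictGraph C) (fun J => J.1 ⊆ A) π v), n) ∧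
      n ≤ if Disjoint D v.1 then 0
        else callTreeSize (conflictGraph C) (fun J => J.1 ⊆ A) π v := by
  by_cases hd : Disjoint D v.1
  · refine ⟨0, ?_, Nat.zero_le _⟩
    rw [partner, if_pos hd]
    simp only [hd, not_true_eq_false, false_and, decide_false]
    rfl
  · obtain ⟨s, hs, hsA⟩ := exists_partner_eq_some (hC _ v.2) hd hv
    rw [hs, if_neg hd]
    simp only [hd, not_false_eq_true, true_and, OracleProg.run]
    by_cases hsv : s ∈ A
    · obtain ⟨n, hn, hle⟩ := hp ((hsA A hD).1 hsv)
      refine ⟨n + 1, ?_, hle⟩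
      simp only [hsv, decide_true, if_true, hn, PMF.pure_map]
    · refine ⟨1, ?_, one_le_callTreeSize v⟩
      have hg : ¬ Greedy (conflictGraph C) (fun J => J.1 ⊆ A) π v := fun h =>
        hsv ((hsA A hD).2 (greedy_iff.1 h).1)
      simp only [hsv, hg, decide_false, Bool.false_eq_true, if_false]
      exact PMF.pure_map _ _

open scoped Classical in
/-- On a conflict inside the query result, `eliminate` decides membership in the greedy set, with at
most one oracle call for each node of the call tree except the root. -/
theorem run_eliminate (hC : ∀ J ∈ C, J.card = 2) (r : ℕ) (hr : r < C.card)
    (hv : (π.symm ⟨r, hr⟩).1 ⊆ A) :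
    ∃ n, (eliminate π r hr).run A hA = PMF.pure
        (decide (Greedy (conflictGraph C) (fun J => J.1 ⊆ A) π (π.symm ⟨r, hr⟩)), n) ∧
      n + 1 ≤ callTreeSize (conflictGraph C) (fun J => J.1 ⊆ A) π (π.symm ⟨r, hr⟩) := by
  induction r using Nat.strong_induction_on with
  | _ r ih =>
    set v := π.symm ⟨r, hr⟩ with hvdef
    have hπv : π v = ⟨r, hr⟩ := π.apply_symm_apply _
    let u : Fin r → {J // J ∈ C} := fun i => π.symm ⟨i.1, i.2.trans hr⟩
    have hπu : ∀ i, π (u i) = ⟨i.1, i.2.trans hr⟩ := fun i => π.apply_symm_apply _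
    have hne : ∀ i, v ≠ u i := by
      intro i h
      have := congrArg π h
      rw [hπv, hπu, Fin.mk.injEq] at this
      exact i.2.ne' this
    have hadj : ∀ i, (conflictGraph C).Adj v (u i) ↔ ¬ Disjoint v.1 (u i).1 := fun i =>
      ⟨fun h => h.2, fun h => ⟨hne i, h⟩⟩
    have hround : ∀ i : Fin r, _ := fun i =>
      run_visit (A := A) (hA := hA) (π := π) hC v.1 hv (u i)
        (fun hsub => hne i (Subtype.ext (Finset.eq_of_subset_of_card_le hsub
          (by rw [hC _ v.2, hC _ (u i).2])).symm))
        (eliminate π i.1 (i.2.trans hr)) (ih i.1 i.2 (i.2.trans hr))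
    choose c hc hcle using hround
    obtain ⟨n, hn, hle⟩ := OracleProg.run_anyM (A := A) (hA := hA) _ _ c (List.finRange r)
      (List.pairwise_lt_finRange r) fun i _ => hc i
    refine ⟨n + 0, ?_, ?_⟩
    · rw [eliminate]
      refine OracleProg.run_andThen_of_pure_of_pure hn ?_
      change PMF.pure (_, 0) = PMF.pure (_, 0)
      congr 2
      rw [Bool.eq_iff_iff, Bool.not_eq_true', decide_eq_true_iff, greedy_iff, List.any_eq_false]
      simp only [List.mem_finRange, forall_const, decide_eq_true_iff, not_and, hv, true_and, hπv]
      constructor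
      · intro h y hvy hy
        have hyu : u ⟨(π y).1, hy⟩ = y := by simp [u]
        have := h ⟨(π y).1, hy⟩
        rw [hyu] at this
        exact this hvy.2
      · intro h i hd
        refine h (u i) ((hadj i).2 hd) ?_
        rw [hπu]
        exact i.2
    · refine le_trans ?_ (one_add_sum_callTreeSize_le π v)
      rw [add_zero, add_comm]
      refine Nat.add_le_add_left ((hle (Finset.univ.filter fun i => ∀ k < i,
        ¬ (¬ Disjoint v.1 (u k).1 ∧ Greedy (conflictGraph C) (fun J => J.1 ⊆ A) π (u k)))
        fun i _ hi => Finset.mem_filter.2 ⟨Finset.mem_univ _, fun k hki =>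
          of_decide_eq_false (hi k (List.mem_finRange k) hki)⟩).trans
        ((Finset.sum_le_sum fun i _ => hcle i).trans ?_)) _
      rw [← Finset.sum_filter_add_sum_filter_not _ (fun i => Disjoint v.1 (u i).1)]
      rw [Finset.sum_congr rfl (g := fun _ => 0) fun i hi => if_pos (Finset.mem_filter.1 hi).2,
        Finset.sum_const_zero, zero_add,
        Finset.sum_congr rfl fun i hi => if_neg (Finset.mem_filter.1 hi).2]
      have hu : Function.Injective u := by
        intro i j hij
        have := congrArg π hij
        rw [hπu, hπu, Fin.mk.injEq] at this
        exact Fin.ext this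
      rw [← Finset.sum_image (f := fun x => callTreeSize _ _ π x) (g := u) fun _ _ _ _ h => hu h]
      refine Finset.sum_le_sum_of_subset fun x hx => ?_
      obtain ⟨i, hi, rfl⟩ := Finset.mem_image.1 hx
      rw [Finset.mem_filter, Finset.mem_filter] at hi
      rw [Finset.mem_filter]
      refine ⟨Finset.mem_univ _, hv, (hadj i).2 hi.2, ?_, fun z hz hzi hg => ?_⟩
      · rw [hπu, hπv]
        exact i.2
      · rw [hπu] at hzi
        have hzr : (π z).1 < r := lt_trans (Fin.lt_def.1 hzi) i.2
        have hzu : u ⟨(π z).1, hzr⟩ = z := by simp [u]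
        have := hi.1.2 ⟨(π z).1, hzr⟩ hzi
        rw [hzu] at this
        exact this ⟨hz.2, hg⟩

open scoped Classical in
/-- On a tuple of the query result, `notInSR` decides whether a conflict of the greedy matching
covers it. -/
theorem run_notInSR (hC : ∀ J ∈ C, J.card = 2) {t : T} (ht : t ∈ A) :
    ∃ n, (notInSR π t).run A hA = PMF.pure
        (decide (∃ v, t ∈ v.1 ∧ Greedy (conflictGraph C) (fun J => J.1 ⊆ A) π v), n) ∧
      n ≤ ∑ v with t ∈ v.1, callTreeSize (conflictGraph C) (fun J => J.1 ⊆ A) π v := by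
  have hround : ∀ i : Fin C.card, _ := fun i =>
    run_visit (A := A) (hA := hA) (π := π) hC {t} (Finset.singleton_subset_iff.2 ht) (π.symm i)
      (fun hsub => by
        have := Finset.card_le_card hsub
        rw [hC _ (π.symm i).2, Finset.card_singleton] at this
        omega)
      (eliminate π i.1 i.2) (run_eliminate hC i.1 i.2)
  choose c hc hcle using hround
  obtain ⟨n, hn, hle⟩ := OracleProg.run_anyM (A := A) (hA := hA) _ _ c (List.finRange C.card)
    (List.pairwise_lt_finRange _) fun i _ => hc i
  refine ⟨n, ?_, ?_⟩
  · rw [notInSR]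
    refine hn.trans ?_
    congr 2
    rw [Bool.eq_iff_iff, List.any_eq_true, decide_eq_true_iff]
    simp only [List.mem_finRange, true_and, decide_eq_true_iff, Finset.disjoint_singleton_left,
      not_not]
    exact π.symm.exists_congr_left.trans (by simp)
  · refine (hle Finset.univ fun i _ _ => Finset.mem_univ i).trans
      ((Finset.sum_le_sum fun i _ => hcle i).trans ?_)
    rw [Finset.sum_filter, ← Equiv.sum_comp π.symm]
    refine Finset.sum_le_sum fun i _ => ?_
    simp only [Finset.disjoint_singleton_left]
    split_ifs <;> simp_all

end ConflictGraph

/-! ### Sampling -/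

/-- The expectation of a nonnegative function under a discrete law. -/
noncomputable def PMF.expectation {α : Type*} (p : PMF α) (g : α → ENNReal) : ENNReal :=
  ∑' x, p x * g x

namespace PMF

variable {α β : Type*}

theorem expectation_pure (a : α) (g : α → ENNReal) : (PMF.pure a).expectation g = g a := by
  classical
  rw [expectation, tsum_eq_single a]
  · simp
  · intro b hb
    simp [PMF.pure_apply, hb]

theorem expectation_bind (p : PMF α) (f : α → PMF β) (g : β → ENNReal) :
    (p.bind f).expectation g = p.expectation fun a => (f a).expectation g := by
  simp only [expectation, PMF.bind_apply, ← ENNReal.tsum_mul_right, ← ENNReal.tsum_mul_left]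
  rw [ENNReal.tsum_comm]
  simp only [mul_assoc]

theorem expectation_map (p : PMF α) (h : α → β) (g : β → ENNReal) :
    (p.map h).expectation g = p.expectation fun a => g (h a) := by
  rw [PMF.map, expectation_bind]
  simp only [Function.comp_apply, expectation_pure]

theorem expectation_add (p : PMF α) (f g : α → ENNReal) :
    (p.expectation fun x => f x + g x) = p.expectation f + p.expectation g := by
  simp only [expectation, mul_add, ENNReal.tsum_add]

theorem expectation_mul_right (p : PMF α) (f : α → ENNReal) (c : ENNReal) :
    (p.expectation fun x => f x * c) = p.expectation f * c := by
  simp only [expectation, ← mul_assoc, ENNReal.tsum_mul_right]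

theorem expectation_const (p : PMF α) (c : ENNReal) : (p.expectation fun _ => c) = c := by
  rw [expectation, ENNReal.tsum_mul_right, PMF.tsum_coe, one_mul]

theorem expectation_mono (p : PMF α) {f g : α → ENNReal} (h : ∀ x, f x ≤ g x) :
    p.expectation f ≤ p.expectation g :=
  ENNReal.tsum_le_tsum fun x => mul_le_mul_right (h x) _

theorem expectation_indicator_one (p : PMF α) (s : Set α) :
    p.expectation (s.indicator 1) = p.toOuterMeasure s := by
  rw [PMF.toOuterMeasure_apply, expectation]
  refine tsum_congr fun x => ?_
  by_cases hx : x ∈ s <;> simp [hx]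

theorem expectation_uniformOfFinset (A : Finset α) (hA : A.Nonempty) (g : α → ENNReal) :
    (PMF.uniformOfFinset A hA).expectation g = (∑ t ∈ A, g t) / A.card := by
  rw [expectation, tsum_eq_sum (s := A), Finset.sum_congr rfl fun t ht => by
    rw [PMF.uniformOfFinset_apply_of_mem hA ht], ← Finset.mul_sum, mul_comm, div_eq_mul_inv]
  intro t ht
  rw [PMF.uniformOfFinset_apply_of_notMem hA ht, zero_mul]

end PMF

section Sampling

variable {T : Type} {C : Finset (Finset T)} {A : Finset T} {hA : A.Nonempty} {π : Ranking C}
  {b : T → Bool} {c : T → ℕ}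

theorem expectation_run_countNotInSR_succ
    (h : ∀ t ∈ A, (notInSR π t).run A hA = PMF.pure (b t, c t)) (p d : ℕ) (g : ℕ × ℕ → ENNReal) :
    ((countNotInSR π (p + 1) d).run A hA).expectation g =
      (∑ t ∈ A, ((countNotInSR π p (if b t then d + 1 else d)).run A hA).expectation fun y =>
        g (y.1, c t + y.2 + 1)) / A.card := by
  rw [countNotInSR, OracleProg.run, PMF.expectation_bind, PMF.expectation_uniformOfFinset]
  congr 1
  refine Finset.sum_congr rfl fun t ht => ?_
  rw [PMF.expectation_map]
  have := OracleProg.run_andThen_of_pure (f := fun b => countNotInSR π p (if b then d + 1 else d))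
    (h t ht)
  change (((notInSR π t).andThen _).run A hA).expectation _ = _
  rw [this, PMF.expectation_map]

theorem expectation_calls_countNotInSR
    (h : ∀ t ∈ A, (notInSR π t).run A hA = PMF.pure (b t, c t)) (p d : ℕ) :
    (((countNotInSR π p d).run A hA).expectation fun x => (x.2 : ENNReal)) =
      p * (1 + (∑ t ∈ A, (c t : ENNReal)) / A.card) := by
  have hA0 : (A.card : ENNReal) ≠ 0 := by
    exact_mod_cast hA.card_pos.ne'
  induction p generalizing d with
  | zero =>
    rw [countNotInSR]
    refine (PMF.expectation_pure _ _).trans ?_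
    simp
  | succ p ih =>
    rw [expectation_run_countNotInSR_succ h]
    simp only [Nat.cast_add, Nat.cast_one, PMF.expectation_add, PMF.expectation_const, ih]
    rw [Finset.sum_add_distrib, Finset.sum_add_distrib, Finset.sum_const, Finset.sum_const,
      ENNReal.add_div, ENNReal.add_div, nsmul_eq_mul, nsmul_eq_mul, mul_one,
      ENNReal.div_self hA0 (ENNReal.natCast_ne_top _), mul_div_assoc, mul_comm,
      ENNReal.div_mul_cancel hA0 (ENNReal.natCast_ne_top _)]
    ring

/-- The number of successes among `p` uniform samples has mean `p μ` and variance `p μ (1 - μ)`,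
where `μ` is the fraction of successful tuples. -/
theorem expectation_sq_countNotInSR
    (h : ∀ t ∈ A, (notInSR π t).run A hA = PMF.pure (b t, c t)) {μ : ℝ}
    (hμ : μ = ((A.filter fun t => b t = true).card : ℝ) / A.card) (z : ℝ) (p d : ℕ) :
    (((countNotInSR π p d).run A hA).expectation fun x => ENNReal.ofReal ((x.1 - z) ^ 2)) =
      ENNReal.ofReal ((d + p * μ - z) ^ 2 + p * (μ * (1 - μ))) := by
  have hA0 : (0 : ℝ) < A.card := by exact_mod_cast hA.card_pos
  have hμ0 : 0 ≤ μ * (1 - μ) := by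
    refine mul_nonneg (hμ ▸ by positivity) (sub_nonneg.2 ?_)
    rw [hμ, div_le_one hA0]
    exact_mod_cast Finset.card_filter_le _ _
  induction p generalizing d with
  | zero =>
    rw [countNotInSR]
    refine (PMF.expectation_pure _ _).trans ?_
    simp
  | succ p ih =>
    rw [expectation_run_countNotInSR_succ h]
    simp only [ih]
    rw [← ENNReal.ofReal_sum_of_nonneg fun t _ => by positivity, ← ENNReal.ofReal_natCast A.card,
      ← ENNReal.ofReal_div_of_pos hA0]
    congr 1
    have hterm : ∀ t ∈ A, ((((if b t = true then d + 1 else d : ℕ) : ℝ) + p * μ - z) ^ 2 +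
        p * (μ * (1 - μ))) = ((d + p * μ - z) ^ 2 + p * (μ * (1 - μ))) +
          (2 * (d + p * μ - z) + 1) * (if b t = true then 1 else 0) := by
      intro t _
      split_ifs
      · push_cast
        ring
      · ring
    rw [Finset.sum_congr rfl hterm, Finset.sum_add_distrib, Finset.sum_const, ← Finset.mul_sum,
      Finset.sum_boole, nsmul_eq_mul, add_div, mul_div_assoc _ (Finset.card _ : ℝ), ← hμ,
      mul_div_cancel_left₀ _ hA0.ne']
    push_cast
    ring

theorem three_le_numSamples_mul_sq {ε : ℝ} (h0 : 0 < ε) (h1 : ε < 1) :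
    3 ≤ (numSamples ε : ℝ) * ε ^ 2 := by
  have hlt : 8 / ε ^ 2 < numSamples ε + 1 := Nat.lt_floor_add_one _
  rw [div_lt_iff₀ (by positivity)] at hlt
  -- `8 < (numSamples ε + 1) * ε ^ 2` and `ε ^ 2 < 1`.
  nlinarith

theorem run_fastIncDeg (ε : ℝ) :
    (fastIncDeg π ε).run A hA = ((countNotInSR π (numSamples ε) 0).run A hA).map fun x =>
      ((x.1 : ℝ) / numSamples ε * A.card / A.card + ε / 2, x.2 + 1) := by
  rw [fastIncDeg]
  refine (OracleProg.run_andThen _ _).trans ?_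
  rw [PMF.map]
  congr 1
  funext x
  change PMF.map _ (PMF.map _ (PMF.pure _)) = _
  rw [PMF.pure_map, PMF.pure_map]
  rfl

theorem expectedCalls_fastIncDeg
    (h : ∀ t ∈ A, (notInSR π t).run A hA = PMF.pure (b t, c t)) (ε : ℝ) :
    (fastIncDeg π ε).expectedCalls A hA =
      numSamples ε * (1 + (∑ t ∈ A, (c t : ENNReal)) / A.card) + 1 := by
  rw [← expectation_calls_countNotInSR h (numSamples ε) 0, OracleProg.expectedCalls, run_fastIncDeg]
  refine (PMF.expectation_map _ _ _).trans ?_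
  simp only [Nat.cast_add, Nat.cast_one, PMF.expectation_add, PMF.expectation_const]

/-- Chebyshev's inequality: the estimate lies between `μ` and `μ + ε` with probability at
least `2 / 3`, where `μ` is the fraction of tuples on which `notInSR` returns `true`. -/
theorem two_thirds_le_prob_fastIncDeg
    (h : ∀ t ∈ A, (notInSR π t).run A hA = PMF.pure (b t, c t)) {μ : ℝ}
    (hμ : μ = ((A.filter fun t => b t = true).card : ℝ) / A.card) {ε : ℝ} (h0 : 0 < ε) (h1 : ε < 1)
    (P : ℝ → Prop) (hP : ∀ x, μ ≤ x → x ≤ μ + ε → P x) :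
    2 / 3 ≤ (fastIncDeg π ε).prob A hA P := by
  have hA0 : (0 : ℝ) < A.card := by exact_mod_cast hA.card_pos
  have h3 := three_le_numSamples_mul_sq h0 h1
  set s := numSamples ε
  have hs : (0 : ℝ) < s := by
    by_contra hc
    have : (s : ℝ) * ε ^ 2 ≤ 0 := mul_nonpos_of_nonpos_of_nonneg (not_lt.1 hc) (sq_nonneg ε)
    linarith
  -- The tolerated deviation of the count from its mean `s * μ`.
  set r : ℝ := s * ε / 2 with hr
  have hr0 : 0 < r := by positivity
  set p := (countNotInSR π s 0).run A hA
  set S : Set (ℕ × ℕ) := {x | P ((x.1 : ℝ) / s * A.card / A.card + ε / 2)}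
  have hprob : (fastIncDeg π ε).prob A hA P = p.expectation (S.indicator 1) := by
    rw [OracleProg.prob, run_fastIncDeg, PMF.toOuterMeasure_map_apply,
      PMF.expectation_indicator_one]
    rfl
  have hpoint : ∀ x : ℕ × ℕ, 1 ≤ S.indicator (1 : ℕ × ℕ → ENNReal) x +
      ENNReal.ofReal ((x.1 - s * μ) ^ 2) * ENNReal.ofReal (1 / r ^ 2) := by
    intro x
    by_cases hx : x ∈ S
    · rw [Set.indicator_of_mem hx]
      exact le_self_add
    · refine le_add_of_nonneg_of_le bot_le ?_
      rw [← ENNReal.ofReal_mul (sq_nonneg _), ENNReal.one_le_ofReal, mul_one_div,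
        one_le_div (by positivity)]
      by_contra hlt
      obtain ⟨ha, hb⟩ := abs_lt_of_sq_lt_sq' (not_le.1 hlt) hr0.le
      refine hx (hP _ ?_ ?_)
      · rw [mul_div_cancel_right₀ _ hA0.ne', ← sub_le_iff_le_add, le_div_iff₀ hs]
        linarith
      · rw [mul_div_cancel_right₀ _ hA0.ne', ← le_sub_iff_add_le, div_le_iff₀ hs]
        linarith
  have hE := p.expectation_mono hpoint
  rw [PMF.expectation_const, PMF.expectation_add, PMF.expectation_mul_right, ← hprob,
    expectation_sq_countNotInSR h hμ, ← ENNReal.ofReal_mul' (by positivity)] at hE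
  have hq : (((0 : ℕ) : ℝ) + s * μ - s * μ) ^ 2 + s * (μ * (1 - μ)) ≤ r ^ 2 / 3 := by
    have : s * (μ * (1 - μ)) ≤ s * (1 / 4) :=
      mul_le_mul_of_nonneg_left (by nlinarith [sq_nonneg (μ - 1 / 2)]) hs.le
    have h4 : r ^ 2 / 3 = s * (s * ε ^ 2 / 12) := by rw [hr]; ring
    have h5 : s * (1 / 4) ≤ s * (s * ε ^ 2 / 12) := mul_le_mul_of_nonneg_left (by linarith) hs.le
    rw [Nat.cast_zero, zero_add, sub_self, h4]
    linarith
  have hq' := mul_le_mul_of_nonneg_right hq (show 0 ≤ 1 / r ^ 2 by positivity)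
  rw [show r ^ 2 / 3 * (1 / r ^ 2) = 1 / 3 by field_simp] at hq'
  have hthird : ENNReal.ofReal (1 / 3) = 1 / 3 := by
    rw [ENNReal.ofReal_div_of_pos (by norm_num)]
    norm_num
  have hfin := hE.trans (add_le_add_right (ENNReal.ofReal_le_ofReal hq') _)
  rw [hthird] at hfin
  have hone : (2 / 3 : ENNReal) + 1 / 3 = 1 := by
    rw [← ENNReal.add_div, show (2 : ENNReal) + 1 = 3 by norm_num,
      ENNReal.div_self (by norm_num) (by norm_num)]
  exact (ENNReal.add_le_add_iff_right (by simp)).1 (hone.le.trans hfin)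

end Sampling

/-! ### The greedy matching of conflicts and the inconsistency degree -/

section Repair

variable {k : ℕ} {dom : Fin k → Type} {F : Finset (FunDep k)} {I A : Finset (DBTuple dom)}

theorem mem_conflicts {J : Finset (DBTuple dom)} :
    J ∈ conflicts F I ↔ (J ⊆ I ∧ J.card = 2) ∧ ¬ Consistent F J := by
  simp only [conflicts, Finset.mem_filter, Finset.mem_powersetCard]

theorem Consistent.mono {J J' : Finset (DBTuple dom)} (h : Consistent F J) (hs : J' ⊆ J) :
    Consistent F J' :=
  fun φ hφ s h_s t ht => h φ hφ s (hs h_s) t (hs ht)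

variable {π : Ranking (conflicts F I)}

open scoped Classical in
/-- The greedy matching is maximal, so the tuples it leaves uncovered form a consistent set. -/
theorem incDeg_le_card_covered (hAI : A ⊆ I) :
    incDeg F A ≤ ((A.filter fun t => ∃ v : {J // J ∈ conflicts F I}, t ∈ v.1 ∧
      Greedy (conflictGraph (conflicts F I)) (fun J => J.1 ⊆ A) π v).card : ℝ) / A.card := by
  set M := A.filter fun t => ∃ v : {J // J ∈ conflicts F I}, t ∈ v.1 ∧
      Greedy (conflictGraph (conflicts F I)) (fun J => J.1 ⊆ A) π v
  have hcons : Consistent F (A \ M) := by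
    intro φ hφ s h_s t ht hl i hi
    by_contra hne
    have hst : s ≠ t := fun h => hne (h ▸ rfl)
    rw [Finset.mem_sdiff] at h_s ht
    have hsub : ({s, t} : Finset (DBTuple dom)) ⊆ A := by
      simp [Finset.insert_subset_iff, h_s.1, ht.1]
    have hmem : {s, t} ∈ conflicts F I := by
      refine mem_conflicts.2 ⟨⟨hsub.trans hAI, Finset.card_pair hst⟩, fun hc => hne ?_⟩
      exact hc φ hφ s (by simp) t (by simp) hl i hi
    obtain ⟨w, hw, x, hx, hxw⟩ : ∃ w : {J // J ∈ conflicts F I},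
        Greedy (conflictGraph (conflicts F I)) (fun J => J.1 ⊆ A) π w ∧
          ∃ x ∈ ({s, t} : Finset (DBTuple dom)), x ∈ w.1 := by
      by_cases hg : Greedy (conflictGraph (conflicts F I)) (fun J => J.1 ⊆ A) π ⟨{s, t}, hmem⟩
      · exact ⟨_, hg, s, by simp, by simp⟩
      · rw [greedy_iff] at hg
        push Not at hg
        obtain ⟨y, hy, -, hyg⟩ := hg hsub
        exact ⟨y, hyg, Finset.not_disjoint_iff.1 hy.2⟩
    have hxM : x ∈ M := Finset.mem_filter.2 ⟨hsub hx, w, hxw, hw⟩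
    rw [Finset.mem_insert, Finset.mem_singleton] at hx
    rcases hx with rfl | rfl
    · exact h_s.2 hxM
    · exact ht.2 hxM
  have hmem : A \ M ∈ consistentSubsets F A :=
    Finset.mem_filter.2 ⟨Finset.mem_powerset.2 Finset.sdiff_subset, hcons⟩
  refine (Finset.inf'_le _ hmem).trans_eq ?_
  rw [distSub, Finset.sdiff_sdiff_eq_self (Finset.filter_subset _ _)]

open scoped Classical in
/-- The conflicts of the greedy matching are disjoint, and a consistent subset misses a tuple of
each of them. -/
theorem card_covered_le_two_mul_incDeg :
    ((A.filter fun t => ∃ v : {J // J ∈ conflicts F I}, t ∈ v.1 ∧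
      Greedy (conflictGraph (conflicts F I)) (fun J => J.1 ⊆ A) π v).card : ℝ) / A.card ≤
      2 * incDeg F A := by
  obtain ⟨J, hJ, hmin⟩ := Finset.exists_mem_eq_inf' (consistentSubsets_nonempty F A)
    fun J => (distSub J A : ℝ) / (A.card : ℝ)
  rw [incDeg, hmin, ← mul_div_assoc]
  refine div_le_div_of_nonneg_right ?_ (Nat.cast_nonneg _)
  have hJc := (Finset.mem_filter.1 hJ).2
  set W := Finset.univ.filter fun v : {J // J ∈ conflicts F I} =>
    Greedy (conflictGraph (conflicts F I)) (fun J => J.1 ⊆ A) π v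
  have hcover : (A.filter fun t => ∃ v : {J // J ∈ conflicts F I}, t ∈ v.1 ∧
      Greedy (conflictGraph (conflicts F I)) (fun J => J.1 ⊆ A) π v).card ≤ W.card * 2 := by
    refine (Finset.card_le_card (t := W.biUnion fun v => v.1) fun t ht => ?_).trans
      (Finset.card_biUnion_le_card_mul _ _ _ fun v _ => (mem_conflicts.1 v.2).1.2.le)
    obtain ⟨v, htv, hv⟩ := (Finset.mem_filter.1 ht).2
    exact Finset.mem_biUnion.2 ⟨v, Finset.mem_filter.2 ⟨Finset.mem_univ _, hv⟩, htv⟩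
  have hmiss : ∀ v : {J // J ∈ conflicts F I}, ∃ t ∈ v.1, t ∉ J := by
    intro v
    by_contra! hc
    exact (mem_conflicts.1 v.2).2 (hJc.mono hc)
  choose f hfv hfJ using hmiss
  have hle : W.card ≤ distSub J A := by
    refine Finset.card_le_card_of_injOn f (fun v hv => ?_) fun v hv w hw hvw => ?_
    · exact Finset.mem_sdiff.2 ⟨(greedy_iff.1 (Finset.mem_filter.1 hv).2).1 (hfv v), hfJ v⟩
    · have hv' := (Finset.mem_filter.1 hv).2
      have hw' := (Finset.mem_filter.1 hw).2
      by_contra hne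
      have hadj : (conflictGraph (conflicts F I)).Adj v w :=
        ⟨hne, Finset.not_disjoint_iff.2 ⟨f v, hfv v, hvw ▸ hfv w⟩⟩
      rcases lt_trichotomy (π v) (π w) with h | h | h
      · exact (greedy_iff.1 hw').2 v hadj.symm h hv'
      · exact hne (π.injective h)
      · exact (greedy_iff.1 hv').2 w hadj h hw'
  have : (A.filter fun t => ∃ v : {J // J ∈ conflicts F I}, t ∈ v.1 ∧
      Greedy (conflictGraph (conflicts F I)) (fun J => J.1 ⊆ A) π v).card ≤ 2 * distSub J A := by
    omega
  exact_mod_cast this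

/-! ### The number of oracle calls -/

open scoped Classical in
theorem card_conflicts_containing_le (t : DBTuple dom) :
    (Finset.univ.filter fun v : {J // J ∈ conflicts F I} => t ∈ v.1).card ≤ maxConflicts F I := by
  rcases (Finset.univ.filter fun v : {J // J ∈ conflicts F I} => t ∈ v.1).eq_empty_or_nonempty
    with h | ⟨w, hw⟩
  · rw [h]
    exact Nat.zero_le _
  · have ht : t ∈ I := (mem_conflicts.1 w.2).1.1 (Finset.mem_filter.1 hw).2
    refine le_trans ?_ (Finset.le_sup (f := fun t => ((conflicts F I).filter fun J => t ∈ J).card) ht)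
    refine Finset.card_le_card_of_injOn Subtype.val (fun v hv => ?_) Subtype.val_injective.injOn
    exact Finset.mem_filter.2 ⟨v.2, (Finset.mem_filter.1 hv).2⟩

open scoped Classical in
/-- The visits made for all tuples of `A` together, averaged over the rankings, are quadratic in the
largest number of conflicts per tuple: at most `|A| D` conflicts meet `A`, each has at most `2 D`
neighbours, and each conflict is searched from at most two tuples. -/
theorem sum_sum_callTreeSize_containing_le (A : Finset (DBTuple dom)) :
    ∑ π : Ranking (conflicts F I), ∑ t ∈ A, ∑ v : {J // J ∈ conflicts F I} with t ∈ v.1,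
      callTreeSize (conflictGraph (conflicts F I)) (fun J => J.1 ⊆ A) π v ≤
      6 * max 1 (maxConflicts F I) ^ 2 * A.card * (conflicts F I).card.factorial := by
  set D := max 1 (maxConflicts F I)
  let V := {J // J ∈ conflicts F I}
  let N : DBTuple dom → Finset V := fun t => Finset.univ.filter fun v => t ∈ v.1
  have hN : ∀ t, (N t).card ≤ D := fun t => (card_conflicts_containing_le t).trans (le_max_right _ _)
  -- The conflicts that meet `A`, and the ordered pairs of such a conflict and one adjacent to it.
  let S : Finset V := A.biUnion N
  let E : Finset (V × V) := S.biUnion fun v => (v.1.biUnion N).image fun u => (u, v)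
  have hS : S.card ≤ A.card * D := Finset.card_biUnion_le_card_mul _ _ _ fun t _ => hN t
  have hE : E.card ≤ S.card * (2 * D) := by
    refine Finset.card_biUnion_le_card_mul _ _ _ fun v _ => Finset.card_image_le.trans ?_
    rw [← (mem_conflicts.1 v.2).1.2]
    exact Finset.card_biUnion_le_card_mul _ _ _ fun t _ => hN t
  have hmain := sum_sum_callTreeSize_le (m := (conflicts F I).card)
    (G := conflictGraph (conflicts F I)) (live := fun J => J.1 ⊆ A) S E (by
      intro v u hv hvu
      obtain ⟨t, htv, htu⟩ := Finset.not_disjoint_iff.1 hvu.2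
      refine Finset.mem_biUnion.2 ⟨v, Finset.mem_biUnion.2 ⟨t, hv htv, by simpa [N] using htv⟩, ?_⟩
      exact Finset.mem_image.2 ⟨u, Finset.mem_biUnion.2 ⟨t, htv, by simpa [N] using htu⟩, rfl⟩)
  have hfact : Fintype.card (V ≃ Fin (conflicts F I).card) = (conflicts F I).card.factorial := by
    rw [Fintype.card_equiv (Finset.equivFin _), Fintype.card_coe]
  rw [hfact] at hmain
  have hswap : ∀ π : Ranking (conflicts F I), ∑ t ∈ A, ∑ v : V with t ∈ v.1,
      callTreeSize (conflictGraph (conflicts F I)) (fun J => J.1 ⊆ A) π v ≤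
      2 * ∑ v ∈ S, callTreeSize (conflictGraph (conflicts F I)) (fun J => J.1 ⊆ A) π v := by
    intro π
    rw [Finset.sum_comm' (t' := S) (s' := fun v => A.filter fun t => t ∈ v.1), Finset.mul_sum]
    · refine Finset.sum_le_sum fun v _ => ?_
      rw [Finset.sum_const, smul_eq_mul]
      refine Nat.mul_le_mul_right _ ?_
      rw [← (mem_conflicts.1 v.2).1.2]
      exact Finset.card_le_card fun t ht => (Finset.mem_filter.1 ht).2
    · intro t v
      simp only [S, N, Finset.mem_biUnion, Finset.mem_filter, Finset.mem_univ, true_and]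
      exact ⟨fun h => ⟨h, t, h⟩, fun h => h.1⟩
  refine (Finset.sum_le_sum fun π _ => hswap π).trans ?_
  rw [← Finset.mul_sum]
  have hD : 1 ≤ D := le_max_left _ _
  have hcount : 2 * (S.card + E.card) ≤ 6 * D ^ 2 * A.card := by
    have h1 : S.card ≤ A.card * D ^ 2 := hS.trans (Nat.mul_le_mul_left _ (by nlinarith))
    have h2 : E.card ≤ A.card * D * (2 * D) := hE.trans (Nat.mul_le_mul_right _ hS)
    nlinarith
  calc _ ≤ 2 * ((S.card + E.card) * (conflicts F I).card.factorial) := Nat.mul_le_mul_left _ hmain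
    _ = 2 * (S.card + E.card) * (conflicts F I).card.factorial := by ring
    _ ≤ _ := Nat.mul_le_mul_right _ hcount

open scoped Classical in
/-- The bound on the average number of calls for one query result `A`. Averaging over a uniform
sample turns the total cost over the tuples of `A` into the mean cost of one search. -/
theorem sum_expectedCalls_fastIncDeg_le (hA : A.Nonempty) {ε : ℝ} (h0 : 0 < ε) (h1 : ε < 1) :
    ∑ π : Ranking (conflicts F I), (fastIncDeg π ε).expectedCalls A hA ≤
      ENNReal.ofReal (64 * (max 1 (maxConflicts F I : ℝ)) ^ 2 / ε ^ 2) *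
        (conflicts F I).card.factorial := by
  set m := (conflicts F I).card
  set D := max 1 (maxConflicts F I) with hD
  set s := numSamples ε
  have hC : ∀ J ∈ conflicts F I, J.card = 2 := fun J hJ => (mem_conflicts.1 hJ).1.2
  have hrank : Fintype.card (Ranking (conflicts F I)) = m.factorial := by
    rw [Fintype.card_equiv (Finset.equivFin _), Fintype.card_coe]
  have hcost : ∀ π : Ranking (conflicts F I), (fastIncDeg π ε).expectedCalls A hA ≤
      s * (1 + ((∑ t ∈ A, ∑ v : {J // J ∈ conflicts F I} with t ∈ v.1,
        callTreeSize (conflictGraph (conflicts F I)) (fun J => J.1 ⊆ A) π v : ℕ) : ENNReal) /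
          A.card) + 1 := by
    intro π
    choose! c hc using fun t (ht : t ∈ A) => run_notInSR (hA := hA) (π := π) hC ht
    rw [expectedCalls_fastIncDeg fun t ht => (hc t ht).1]
    rw [← Nat.cast_sum]
    gcongr with t ht
    -- The two sides differ only in the decidability instances of the filters.
    exact (hc t ht).2.trans_eq (by congr!)
  refine (Finset.sum_le_sum fun π _ => hcost π).trans ?_
  rw [Finset.sum_add_distrib, ← Finset.mul_sum, Finset.sum_add_distrib]
  simp only [div_eq_mul_inv]
  rw [← Finset.sum_mul, Finset.sum_const, Finset.card_univ, hrank, nsmul_eq_mul, mul_one,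
    ← div_eq_mul_inv]
  have htree : (∑ π : Ranking (conflicts F I), ((∑ t ∈ A, ∑ v : {J // J ∈ conflicts F I}
      with t ∈ v.1, callTreeSize (conflictGraph (conflicts F I)) (fun J => J.1 ⊆ A) π v : ℕ) :
        ENNReal)) / A.card ≤ (6 * D ^ 2 * m.factorial : ℕ) := by
    refine ENNReal.div_le_of_le_mul ?_
    have := sum_sum_callTreeSize_containing_le (F := F) (I := I) A
    have h' : 6 * D ^ 2 * A.card * m.factorial = 6 * D ^ 2 * m.factorial * A.card := by ring
    rw [h'] at this
    exact_mod_cast this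
  have hnum : ((s * (1 + 6 * D ^ 2) + 1 : ℕ) : ENNReal) ≤
      ENNReal.ofReal (64 * (max 1 (maxConflicts F I : ℝ)) ^ 2 / ε ^ 2) := by
    rw [← ENNReal.ofReal_natCast]
    refine ENNReal.ofReal_le_ofReal ?_
    have hDr : (max 1 (maxConflicts F I : ℝ)) = D := by
      rw [hD]
      push_cast
      rfl
    have hs3 := three_le_numSamples_mul_sq h0 h1
    have hs8 : (s : ℝ) ≤ 8 / ε ^ 2 := Nat.floor_le (by positivity)
    rw [le_div_iff₀ (by positivity)] at hs8
    have hD1 : (1 : ℝ) ≤ D := by exact_mod_cast le_max_left 1 _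
    have hε : ε ^ 2 ≤ 1 := by nlinarith
    have hD2 : (1 : ℝ) ≤ (D : ℝ) ^ 2 := by nlinarith
    rw [hDr, le_div_iff₀ (by positivity)]
    push_cast
    nlinarith [mul_nonneg (sub_nonneg.2 hs8) (sq_nonneg (D : ℝ))]
  calc _ ≤ (s : ENNReal) * (m.factorial + (6 * D ^ 2 * m.factorial : ℕ)) + m.factorial := by
        gcongr
    _ = ((s * (1 + 6 * D ^ 2) + 1 : ℕ) : ENNReal) * m.factorial := by
        push_cast
        ring
    _ ≤ _ := mul_le_mul_left (by simpa only [div_eq_mul_inv] using hnum) _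

end Repair

theorem theorem5 :
    (∀ (k : ℕ) (dom : Fin k → Type) (F : Finset (FunDep k)) (I : Finset (DBTuple dom))
      (Q : SubsetQuery dom) (hQ : (Q.result I).Nonempty) (π : Ranking (conflicts F I))
      (ε : ℝ), 0 < ε → ε < 1 →
      2 / 3 ≤ (fastIncDeg π ε).prob (Q.result I) hQ fun est =>
        incDeg F (Q.result I) ≤ est ∧ est ≤ 2 * incDeg F (Q.result I) + ε) ∧
    (∃ K : ℝ, ∀ (k : ℕ) (dom : Fin k → Type) (F : Finset (FunDep k)) (I : Finset (DBTuple dom))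
      (Qs : Finset (SubsetQuery dom)) (_ : Qs.Nonempty) (hQs : ∀ Q ∈ Qs, (Q.result I).Nonempty)
      (ε : ℝ), 0 < ε → ε < 1 →
      averageCalls F I Qs hQs ε ≤
        ENNReal.ofReal (K * (max 1 (maxConflicts F I : ℝ)) ^ 2 / ε ^ 2)) := by
  classical
  refine ⟨fun k dom F I Q hQ π ε h0 h1 => ?_, 64, fun k dom F I Qs hne hQs ε h0 h1 => ?_⟩
  · have hC : ∀ J ∈ conflicts F I, J.card = 2 := fun J hJ => (mem_conflicts.1 hJ).1.2
    choose! c hc using fun t (ht : t ∈ Q.result I) => run_notInSR (hA := hQ) (π := π) hC ht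
    refine two_thirds_le_prob_fastIncDeg (fun t ht => (hc t ht).1) rfl h0 h1 _ fun x hx hx' => ?_
    simp only [decide_eq_true_eq] at hx hx'
    exact ⟨(incDeg_le_card_covered (Q.result_subset I)).trans hx,
      hx'.trans (add_le_add_left card_covered_le_two_mul_incDeg _)⟩
  · rw [averageCalls]
    refine ENNReal.div_le_of_le_mul ?_
    simp only [div_eq_mul_inv]
    rw [← Finset.sum_mul, ← div_eq_mul_inv, Finset.sum_comm]
    refine ENNReal.div_le_of_le_mul ((Finset.sum_le_sum fun Q _ =>
      sum_expectedCalls_fastIncDeg_le (hQs Q.1 Q.2) h0 h1).trans_eq ?_)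
    rw [Finset.sum_const, Finset.card_attach, nsmul_eq_mul, mul_comm, div_eq_mul_inv]
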